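/- Let $q\in\mathbf C$ with $0<|q|<1$, let $\theta_q(x)=\prod_{n\ge 0}(1+q^nx)(1+q^{n+1}/x)$ for $x\in\mathbf C^*$, and write $c\equiv d$ if $c/d\in q^{\mathbf Z}$. Let $\rho_1,\rho_2,\sigma_1,\sigma_2,x_1,x_2,x_3,x_4\in\mathbf C^*$ satisfy $\rho_1\not\equiv\rho_2$, $\sigma_1\not\equiv\sigma_2$, $x_k\not\equiv x_l$ for $k\ne l$, and $x_1x_2x_3x_4=\rho_1\rho_2/(\sigma_1\sigma_2)$. Let $V^{(*)}$ be the set of $2\times 2$ matrices $M=(m_{i,j})$ of holomorphic functions on $\mathbf C^*$ such that, for all $i,j$, $m_{i,j}$ is not identically zero and $m_{i,j}(qx)=(\rho_i/\sigma_j)\,x^{-2}\,m_{i,j}(x)$. For a $2\times 2$ complex matrix $A=(a_{i,j})$ of rank $1$, let $\rho(A)\in\mathbf P^1(\mathbf C)=\mathbf C\cup\{\infty\}$ be the point $a_{1,2}/a_{1,1}=a_{2,2}/a_{2,1}$ (a zero row being disregarded). Let $\mathbf C^*$ act diagonally by multiplication on $(\mathbf P^1(\mathbf C))^4$. If all the matrices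 $M(x_k)$ have rank $1$, let $[\rho](M)\in(\mathbf P^1(\mathbf C))^4/\mathbf C^*$ be the class of $(\rho(M(x_1)),\dots,\rho(M(x_4)))$. Then: 1. If $M\in V^{(*)}$ and $\det M=0$ identically, then every $M(x_k)$ has rank $1$, so that $[\rho](M)$ is defined. 2. For all $t\in\mathbf C^*$ and all $k$, $\theta_q(\sigma_2x_kt)$ and $\theta_q(\sigma_1x_kt)$ do not both vanish, so that $f_k(t)=\theta_q(\sigma_2x_kt)/\theta_q(\sigma_1x_kt)\in\mathbf P^1(\mathbf C)$ is defined. The image under $[\rho]$ of the locus $\{M\in V^{(*)}:\det M=0\}$ is exactly the set of classes of the points $(f_1(t),f_2(t),f_3(t),f_4(t))$, $t\in\mathbf C^*$. 3. There is a two-dimensional linear subspace $P\subset\mathbf C^6$ such that, for every $(A,B,C,D,E,F)\in P$, every point $(\rho,\sigma,\tau,\tau')\in(\mathbf P^1(\mathbf C))^4$ whose class belongs to this image satisfies $$A\rho\sigma+B\tau\tau'+C\rho\tau-D\rho\tau'-E\sigma\tau+F\sigma\tau'=0,$$ where, if some coordinates are infinite, the equation is understood in its multihomogeneous form (write each coordinate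 as a quotient of homogeneous coordinates and multiply by the four denominators). -/

import Mathlib

open scoped LinearAlgebra.Projectivization

noncomputable section

/-- Congruence of nonzero complex numbers modulo the subgroup `q ^ ℤ`. -/
def QCongr (q c d : ℂ) : Prop := ∃ n : ℤ, c / d = q ^ n

/-- The theta function `θ_q(x) = (-x; q)_∞ (-q/x; q)_∞`, for `0 < |q| < 1` and `x ≠ 0`. It satisfies
`θ_q(q x) = x⁻¹ θ_q(x)` and vanishes exactly on `-q ^ ℤ`. -/
def thetaQ (q x : ℂ) : ℂ :=
  (∏' n : ℕ, (1 + q ^ n * x)) * ∏' n : ℕ, (1 + q ^ (n + 1) / x)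

/-- The space `V_{k,c}` of holomorphic functions on `ℂ \ {0}` with `m (q x) = c x ^ (-k) m x`.
A function on `ℂ \ {0}` is encoded by its extension by the value `0` at `0`, so that `m = 0` in this
space means that `m` vanishes identically on `ℂ \ {0}`. -/
def qSpace (q : ℂ) (k : ℕ) (c : ℂ) : Submodule ℂ (ℂ → ℂ) where
  carrier := {m | DifferentiableOn ℂ m {0}ᶜ ∧ m 0 = 0 ∧
    ∀ x : ℂ, x ≠ 0 → m (q * x) = c * (x ^ k)⁻¹ * m x}
  add_mem' := by
    rintro f g ⟨hf, hf0, hfq⟩ ⟨hg, hg0, hgq⟩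
    refine ⟨hf.add hg, by simp [hf0, hg0], fun x hx => ?_⟩
    simp only [Pi.add_apply, hfq x hx, hgq x hx]
    ring
  zero_mem' := ⟨differentiableOn_const 0, rfl, fun x _ => by simp⟩
  smul_mem' := by
    rintro a f ⟨hf, hf0, hfq⟩
    refine ⟨hf.const_smul a, by simp [hf0], fun x hx => ?_⟩
    simp only [Pi.smul_apply, smul_eq_mul, hfq x hx]
    ring

/-- `V^{(*)}`: the matrices `M = (m_{i,j})` with `0 ≠ m_{i,j} ∈ V_{2, ρ_i / σ_j}` for all `i, j`. -/
def vStar (q : ℂ) (ρ σ : Fin 2 → ℂ) : Set (Matrix (Fin 2) (Fin 2) (ℂ → ℂ)) :=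
  {M | ∀ i j, M i j ∈ qSpace q 2 (ρ i / σ j) ∧ M i j ≠ 0}

/-- The locus `det M = 0` inside `V^{(*)}` (the determinant is a function). -/
def detLocus (q : ℂ) (ρ σ : Fin 2 → ℂ) : Set (Matrix (Fin 2) (Fin 2) (ℂ → ℂ)) :=
  {M | M ∈ vStar q ρ σ ∧ M.det = 0}

/-- The value `M(x)` of a matrix of functions. -/
def evalAt (M : Matrix (Fin 2) (Fin 2) (ℂ → ℂ)) (x : ℂ) : Matrix (Fin 2) (Fin 2) ℂ :=
  M.map fun m => m x

/-- The complex projective line. A point `[a : b]` has affine coordinate `a / b`. -/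
abbrev P1 : Type := ℙ ℂ (Fin 2 → ℂ)

/-- The linear map `(a, b) ↦ (c a, b)`. -/
def scaleLin (c : ℂˣ) : (Fin 2 → ℂ) →ₗ[ℂ] (Fin 2 → ℂ) where
  toFun v := ![(c : ℂ) * v 0, v 1]
  map_add' v w := by
    ext i; fin_cases i <;> simp [mul_add]
  map_smul' a v := by
    ext i; fin_cases i <;> simp [mul_left_comm]

theorem scaleLin_injective (c : ℂˣ) : Function.Injective (scaleLin c) := by
  intro v w h
  have h0 := congrFun h 0
  have h1 := congrFun h 1
  ext i
  fin_cases i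
  · simpa [scaleLin] using h0
  · simpa [scaleLin] using h1

/-- The action `c • [a : b] = [c a : b]` of `ℂ \ {0}` on the projective line. -/
def scaleP1 (c : ℂˣ) : P1 → P1 := Projectivization.map (scaleLin c) (scaleLin_injective c)

theorem scaleP1_one (p : P1) : scaleP1 1 p = p := by
  induction p using Projectivization.ind with
  | h v hv =>
    simp only [scaleP1, Projectivization.map_mk]
    congr 1
    ext i; fin_cases i <;> simp [scaleLin]

theorem scaleP1_mul (c d : ℂˣ) (p : P1) : scaleP1 (c * d) p = scaleP1 c (scaleP1 d p) := by
  induction p using Projectivization.ind with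
  | h v hv =>
    simp only [scaleP1, Projectivization.map_mk]
    congr 1
    ext i; fin_cases i <;> simp [scaleLin, mul_assoc]

/-- Two points of `(ℙ¹)⁴` are equivalent when they lie in the same orbit of the diagonal action of
`ℂ \ {0}`. -/
instance p1FourSetoid : Setoid (Fin 4 → P1) where
  r p p' := ∃ c : ℂˣ, ∀ k, p' k = scaleP1 c (p k)
  iseqv :=
    { refl := fun p => ⟨1, fun k => (scaleP1_one (p k)).symm⟩
      symm := by
        rintro p p' ⟨c, hc⟩
        exact ⟨c⁻¹, fun k => by rw [hc k, ← scaleP1_mul, inv_mul_cancel, scaleP1_one]⟩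
      trans := by
        rintro p p' p'' ⟨c, hc⟩ ⟨d, hd⟩
        exact ⟨d * c, fun k => by rw [hd k, hc k, scaleP1_mul]⟩ }

/-- The set-theoretic quotient `(ℙ¹)⁴ / (ℂ \ {0})`. -/
abbrev P1FourQuot : Type := Quotient p1FourSetoid

theorem row_swap_ne_zero {A : Matrix (Fin 2) (Fin 2) ℂ} {i : Fin 2} (h : A i ≠ 0) :
    ![A i 1, A i 0] ≠ 0 := by
  intro h'
  apply h
  ext j
  fin_cases j
  · simpa using congrFun h' 1
  · simpa using congrFun h' 0

theorem second_row_ne_zero {A : Matrix (Fin 2) (Fin 2) ℂ} (hA : A.rank = 1) (h : ¬ A 0 ≠ 0) :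
    A 1 ≠ 0 := by
  intro h1
  have h0 : A 0 = 0 := not_not.mp h
  have : A = 0 := by
    ext i j
    fin_cases i
    · exact congrFun h0 j
    · exact congrFun h1 j
  rw [this, Matrix.rank_zero] at hA
  exact zero_ne_one hA

/-- The map `ρ` on `2 × 2` matrices of rank one: the point of the projective line whose affine
coordinate is `a_{1,2} / a_{1,1} = a_{2,2} / a_{2,1}` (a zero row being disregarded). -/
def rhoPoint (A : Matrix (Fin 2) (Fin 2) ℂ) (hA : A.rank = 1) : P1 := by
  classical
  exact if h : A 0 ≠ 0 then Projectivization.mk ℂ ![A 0 1, A 0 0] (row_swap_ne_zero h)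
    else Projectivization.mk ℂ ![A 1 1, A 1 0] (row_swap_ne_zero (second_row_ne_zero hA h))

/-- The map `[ρ]`, sending `M` with all `M(x_k)` of rank one to the class of `(ρ(M(x_k)))_k` modulo
the action of `ℂ \ {0}`. -/
def rhoBracket (x : Fin 4 → ℂ) (M : Matrix (Fin 2) (Fin 2) (ℂ → ℂ))
    (hM : ∀ k, (evalAt M (x k)).rank = 1) : P1FourQuot :=
  Quotient.mk p1FourSetoid fun k => rhoPoint (evalAt M (x k)) (hM k)

/-- The multihomogeneous version of
`A ρ σ + B τ τ' + C ρ τ - D ρ τ' - E σ τ + F σ τ'`, where `(A, …, F) = (a 0, …, a 5)` and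
`ρ, σ, τ, τ'` are the affine coordinates `v k 0 / v k 1`, `k = 0, 1, 2, 3`: the quadratic polynomial
multiplied by the product of the four denominators. -/
def quadricForm (a : Fin 6 → ℂ) (v : Fin 4 → Fin 2 → ℂ) : ℂ :=
  a 0 * (v 0 0 * v 1 0 * v 2 1 * v 3 1)
    + a 1 * (v 2 0 * v 3 0 * v 0 1 * v 1 1)
    + a 2 * (v 0 0 * v 2 0 * v 1 1 * v 3 1)
    - a 3 * (v 0 0 * v 3 0 * v 1 1 * v 2 1)
    - a 4 * (v 1 0 * v 2 0 * v 0 1 * v 3 1)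
    + a 5 * (v 1 0 * v 3 0 * v 0 1 * v 2 1)

/-- The zero locus in `(ℙ¹)⁴` of the quadric with coefficients `a` (the choice of homogeneous
coordinates is immaterial). -/
def quadricLocus (a : Fin 6 → ℂ) : Set (Fin 4 → P1) :=
  {p | quadricForm a (fun k => (p k).rep) = 0}

end

/-! A matrix in `detLocus` is a column times a row of theta functions: its entries are `u i * w j *
θ(x / (ρ i t)) * θ(σ j t x)` for some `t ≠ 0` (`exists_thetaFactorization`). By non-resonance,
neither factor vanishes at any point of `ℂ \ {0}`, so every value has rank one. The row alone
determines `rhoPoint`, and the constant `w 1 / w 0` is absorbed by the diagonal action, which leaves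
the curve of part 2. Conversely, `thetaMatrix` realizes every `t`. The factorization uses three
facts on `qSpace q k c`: its dimension is at most `k`, since Laurent coefficients obey a recurrence
of step `k`; its elements have zeros; and for `k = 2` one zero fixes an element up to a scalar
(`eq_mul_thetaPair_of_zero`). For part 3, substituting the curve into the six monomials gives a
linear map from `ℂ⁶` into some `qSpace q 4 c`, of dimension at most 4. Its kernel contains a plane
`P`. -/

/-! ### The theta function: functional equation and zeros. -/

theorem summable_norm_pow_mul {q : ℂ} (hq1 : ‖q‖ < 1) (x : ℂ) :
    Summable fun n : ℕ => ‖q ^ n * x‖ := by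
  simpa using (summable_geometric_of_lt_one (norm_nonneg q) hq1).mul_right ‖x‖

theorem multipliable_one_add_pow_mul {q : ℂ} (hq1 : ‖q‖ < 1) (x : ℂ) :
    Multipliable fun n : ℕ => 1 + q ^ n * x :=
  multipliable_one_add_of_summable (summable_norm_pow_mul hq1 x)

/-- The `q`-Pochhammer symbol `(-x; q)_∞`. -/
noncomputable def qPoch (q x : ℂ) : ℂ := ∏' n : ℕ, (1 + q ^ n * x)

theorem thetaQ_eq_qPoch (q x : ℂ) : thetaQ q x = qPoch q x * qPoch q (q / x) := by
  unfold thetaQ qPoch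
  congr 2
  ext n
  ring

theorem qPoch_eq_mul {q : ℂ} (hq1 : ‖q‖ < 1) (x : ℂ) :
    qPoch q x = (1 + x) * qPoch q (q * x) := by
  unfold qPoch
  have h : (fun n : ℕ => 1 + q ^ n * (q * x)) = fun n : ℕ => 1 + q ^ (n + 1) * x := by
    ext n; ring
  rw [h, tprod_eq_zero_mul']
  · simp
  · rw [← h]; exact multipliable_one_add_pow_mul hq1 (q * x)

theorem qPoch_eq_zero_iff {q : ℂ} (hq1 : ‖q‖ < 1) (x : ℂ) :
    qPoch q x = 0 ↔ ∃ n : ℕ, 1 + q ^ n * x = 0 := by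
  constructor
  · intro h
    by_contra! hne
    exact tprod_one_add_ne_zero_of_summable hne (summable_norm_pow_mul hq1 x) h
  · exact fun h => tprod_of_exists_eq_zero h

theorem differentiable_qPoch {q : ℂ} (hq1 : ‖q‖ < 1) : Differentiable ℂ (qPoch q) := by
  have key : HasProdLocallyUniformlyOn (fun (n : ℕ) (x : ℂ) => 1 + q ^ n * x) (qPoch q)
      Set.univ := by
    apply hasProdLocallyUniformlyOn_of_forall_compact isOpen_univ
    intro K _ hK
    obtain ⟨R, hR⟩ := hK.isBounded.exists_norm_le
    refine ((summable_geometric_of_lt_one (norm_nonneg q) hq1).mul_right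
      R).hasProdUniformlyOn_nat_one_add hK (.of_forall fun n x hx => ?_) (fun _ => by fun_prop)
    rw [norm_mul, norm_pow]
    gcongr
    exact hR x hx
  rw [← differentiableOn_univ]
  exact key.differentiableOn (.of_forall fun _ => by
    simpa [Finset.prod_fn] using DifferentiableOn.finsetProd (fun _ _ => by fun_prop)) isOpen_univ

theorem differentiableOn_thetaQ {q : ℂ} (hq1 : ‖q‖ < 1) :
    DifferentiableOn ℂ (thetaQ q) {0}ᶜ := by
  have h : thetaQ q = fun x => qPoch q x * qPoch q (q / x) := funext (thetaQ_eq_qPoch q)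
  rw [h]
  refine (differentiable_qPoch hq1).differentiableOn.mul ?_
  refine (differentiable_qPoch hq1).comp_differentiableOn ?_
  exact (differentiableOn_const q).div differentiableOn_id fun x hx => hx

theorem thetaQ_mul {q : ℂ} (hq0 : q ≠ 0) (hq1 : ‖q‖ < 1) {x : ℂ} (hx : x ≠ 0) :
    thetaQ q (q * x) = x⁻¹ * thetaQ q x := by
  rw [thetaQ_eq_qPoch, thetaQ_eq_qPoch, qPoch_eq_mul hq1 x, qPoch_eq_mul hq1 (q / (q * x))]
  have h1 : q / (q * x) = x⁻¹ := by field_simp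
  have h2 : q * x⁻¹ = q / x := by field_simp
  rw [h1, h2]
  field_simp
  ring

theorem thetaQ_eq_zero_iff {q : ℂ} (hq0 : q ≠ 0) (hq1 : ‖q‖ < 1) {x : ℂ} (hx : x ≠ 0) :
    thetaQ q x = 0 ↔ ∃ n : ℤ, x = -q ^ n := by
  rw [thetaQ_eq_qPoch, mul_eq_zero, qPoch_eq_zero_iff hq1, qPoch_eq_zero_iff hq1]
  constructor
  · rintro (⟨n, hn⟩ | ⟨n, hn⟩)
    · refine ⟨-n, ?_⟩
      have hqn : q ^ n ≠ 0 := pow_ne_zero n hq0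
      rw [zpow_neg, zpow_natCast]
      field_simp
      linear_combination hn
    · refine ⟨n + 1, ?_⟩
      rw [zpow_add_one₀ hq0, zpow_natCast]
      field_simp at hn
      linear_combination hn
  · rintro ⟨n, rfl⟩
    obtain ⟨m, rfl | rfl⟩ := Int.eq_nat_or_neg n
    -- The factor `qPoch q (q / x)` starts at `q / x`, so it supplies only the exponents `≥ 1`;
    -- exponent `0` belongs to `qPoch q x`.
    · rcases m with _ | m
      · exact Or.inl ⟨0, by simp⟩
      · refine Or.inr ⟨m, ?_⟩
        have hqn : q ^ (m + 1) ≠ 0 := pow_ne_zero _ hq0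
        rw [zpow_natCast]
        field_simp
        ring
    · refine Or.inl ⟨m, ?_⟩
      have hqn : q ^ m ≠ 0 := pow_ne_zero _ hq0
      rw [zpow_neg, zpow_natCast]
      field_simp
      ring

theorem thetaQ_neg_one {q : ℂ} (hq0 : q ≠ 0) (hq1 : ‖q‖ < 1) : thetaQ q (-1) = 0 :=
  (thetaQ_eq_zero_iff hq0 hq1 (by simp)).2 ⟨0, by simp⟩

theorem qCongr_of_thetaQ_eq_zero {q : ℂ} (hq0 : q ≠ 0) (hq1 : ‖q‖ < 1) {x y : ℂ} (hx : x ≠ 0)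
    (hy : y ≠ 0) (hx' : thetaQ q x = 0) (hy' : thetaQ q y = 0) : QCongr q x y := by
  obtain ⟨n, rfl⟩ := (thetaQ_eq_zero_iff hq0 hq1 hx).1 hx'
  obtain ⟨m, rfl⟩ := (thetaQ_eq_zero_iff hq0 hq1 hy).1 hy'
  exact ⟨n - m, by rw [zpow_sub₀ hq0, neg_div_neg_eq]⟩

/-- The zeros of `θ_q` on `ℂ \ {0}` form a countable set. -/
theorem countable_thetaQ_zeros {q : ℂ} (hq0 : q ≠ 0) (hq1 : ‖q‖ < 1) :
    {x : ℂ | x ≠ 0 ∧ thetaQ q x = 0}.Countable := by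
  refine (Set.countable_range fun n : ℤ => -q ^ n).mono ?_
  rintro x ⟨hx, hx'⟩
  obtain ⟨n, rfl⟩ := (thetaQ_eq_zero_iff hq0 hq1 hx).1 hx'
  exact ⟨n, rfl⟩

/-- A point at which finitely many theta functions do not vanish. -/
theorem exists_thetaQ_ne_zero {q : ℂ} (hq0 : q ≠ 0) (hq1 : ‖q‖ < 1) {ι : Type*} [Finite ι]
    (f : ι → ℂ → ℂ) (hf : ∀ i, Set.InjOn (f i) {0}ᶜ) (hf0 : ∀ i x, x ≠ 0 → f i x ≠ 0) :
    ∃ x : ℂ, x ≠ 0 ∧ ∀ i, thetaQ q (f i x) ≠ 0 := by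
  have hc : ({0} ∪ ⋃ i, {x : ℂ | x ≠ 0 ∧ thetaQ q (f i x) = 0}).Countable := by
    refine (Set.countable_singleton 0).union (Set.countable_iUnion fun i => ?_)
    refine Set.MapsTo.countable_of_injOn (f := f i) (t := {x : ℂ | x ≠ 0 ∧ thetaQ q x = 0}) ?_ ?_
      (countable_thetaQ_zeros hq0 hq1)
    · exact fun x hx => ⟨hf0 i x hx.1, hx.2⟩
    · exact (hf i).mono fun x hx => hx.1
  obtain ⟨x, hx⟩ := (Set.ne_univ_iff_exists_notMem _).1 fun h =>
    not_countable_complex (h ▸ hc)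
  simp only [Set.mem_union, Set.mem_singleton_iff, Set.mem_iUnion, Set.mem_ofPred_eq, not_or,
    not_exists, not_and] at hx
  exact ⟨x, hx.1, fun i => hx.2 i hx.1⟩

/-! ### Circle averages and Laurent coefficients on the punctured plane. -/

open Real in
theorem circleAverage_eq_of_differentiableOn {F : ℂ → ℂ} (hF : DifferentiableOn ℂ F {0}ᶜ)
    {r R : ℝ} (hr : 0 < r) (hle : r ≤ R) :
    circleAverage F 0 R = circleAverage F 0 r := by
  have hsub : ∀ z : ℂ, z ∉ Metric.ball (0 : ℂ) r → z ∈ ({0}ᶜ : Set ℂ) := by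
    rintro z hz rfl
    exact hz (Metric.mem_ball_self hr)
  rw [circleAverage_eq_circleIntegral hr.ne', circleAverage_eq_circleIntegral (hr.trans_le hle).ne',
    Complex.circleIntegral_sub_center_inv_smul_eq_of_differentiable_on_annulus_off_countable hr hle
      Set.countable_empty (hF.continuousOn.mono fun z hz => hsub z hz.2) fun z hz =>
        hF.differentiableAt (isOpen_compl_singleton.mem_nhds
          (hsub z fun h => hz.1.2 (Metric.ball_subset_closedBall h)))]

theorem circleAverage_eq_one {F : ℂ → ℂ} (hF : DifferentiableOn ℂ F {0}ᶜ) {r : ℝ} (hr : 0 < r) :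
    Real.circleAverage F 0 r = Real.circleAverage F 0 1 := by
  rcases le_total r 1 with h | h
  · exact (circleAverage_eq_of_differentiableOn hF hr h).symm
  · exact circleAverage_eq_of_differentiableOn hF one_pos h

-- The map `z ↦ q z` rotates the circle by `arg q` and scales its radius by `‖q‖`; neither operation
-- changes the average.
open Real in
theorem circleAverage_comp_mul {F : ℂ → ℂ} (hF : DifferentiableOn ℂ F {0}ᶜ) {q : ℂ} (hq : q ≠ 0) :
    circleAverage (fun z => F (q * z)) 0 1 = circleAverage F 0 1 := by
  rw [← circleAverage_eq_one hF (norm_pos_iff.2 hq), circleAverage_eq_integral_add (f := F) q.arg,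
    circleAverage_def]
  congr 2
  ext t
  congr 1
  simp only [circleMap, zero_add, Complex.ofReal_one, one_mul, Complex.ofReal_add, add_mul,
    Complex.exp_add]
  linear_combination -Complex.exp (t * Complex.I) * Complex.norm_mul_exp_arg_mul_I q

open Real in
/-- A continuous function on a circle all of whose Fourier coefficients vanish is zero. -/
theorem eq_zero_of_circleAverage_eq_zero {f : ℂ → ℂ} {r : ℝ} (hr : 0 < r)
    (hf : ContinuousOn f {0}ᶜ)
    (h : ∀ n : ℤ, circleAverage (fun z => z ^ (-n) * f z) 0 r = 0) (t : ℝ) :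
    f (circleMap 0 r t) = 0 := by
  have : Fact (0 < 2 * π) := ⟨by positivity⟩
  have hr' : (r : ℂ) ≠ 0 := by exact_mod_cast hr.ne'
  let g : C(AddCircle (2 * π), ℂ) :=
    ⟨fun x => f (r * (AddCircle.toCircle x : ℂ)), by
      refine hf.comp_continuous (continuous_const.mul
        (continuous_subtype_val.comp AddCircle.continuous_toCircle)) fun x => ?_
      simp [hr.ne']⟩
  have hexp : ∀ s : ℝ, (AddCircle.toCircle (s : AddCircle (2 * π)) : ℂ) =
      Complex.exp (s * Complex.I) := by
    intro s
    rw [AddCircle.toCircle_apply_mk, Circle.coe_exp, div_self (by positivity), one_mul]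
  have hg : ∀ s : ℝ, g (s : AddCircle (2 * π)) = f (circleMap 0 r s) := by
    intro s
    change f (r * (AddCircle.toCircle (s : AddCircle (2 * π)) : ℂ)) = _
    rw [hexp, circleMap, zero_add]
  have hcoef : ∀ n : ℤ, fourierCoeff g n = 0 := by
    intro n
    -- The factor `r ^ n` compensates for `z ^ (-n)` being taken on a circle of radius `r` instead
    -- of 1.
    have h1 : ∀ s : ℝ, @fourier (2 * π) (-n) s • g s =
        (r : ℂ) ^ n * ((circleMap 0 r s) ^ (-n) * f (circleMap 0 r s)) := by
      intro s
      have hT : (2 * (π : ℂ) * Complex.I * ((-n : ℤ) : ℂ) * s / ((2 * π : ℝ) : ℂ)) =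
          ((-n : ℤ) : ℂ) * (s * Complex.I) := by
        have : (π : ℂ) ≠ 0 := by exact_mod_cast pi_ne_zero
        push_cast
        field_simp
      rw [hg, fourier_coe_apply, hT, Complex.exp_int_mul, smul_eq_mul]
      simp only [circleMap, zero_add, mul_zpow]
      rw [← mul_assoc, ← mul_assoc, ← zpow_add₀ hr', add_neg_cancel, zpow_zero, one_mul]
    have h2 := h n
    rw [circleAverage_def, smul_eq_zero] at h2
    have h3 := h2.resolve_left (by positivity)
    rw [fourierCoeff_eq_intervalIntegral _ _ 0]
    simp_rw [h1]
    rw [intervalIntegral.integral_const_mul, zero_add, h3, mul_zero, smul_zero]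
  have hs : Summable (fourierCoeff g) := by
    rw [show fourierCoeff g = 0 from funext hcoef]; exact summable_zero
  have h4 := has_pointwise_sum_fourier_series_of_summable hs (t : AddCircle (2 * π))
  simp only [hcoef, zero_smul] at h4
  rw [← hg]
  exact h4.unique hasSum_zero

/-- The `n`-th Laurent coefficient of a holomorphic function on `ℂ \ {0}`. -/
noncomputable def laurentCoeff (f : ℂ → ℂ) (n : ℤ) : ℂ :=
  Real.circleAverage (fun z => z ^ (-n) * f z) 0 1

theorem differentiableOn_zpow_mul {f : ℂ → ℂ} (hf : DifferentiableOn ℂ f {0}ᶜ) (n : ℤ) :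
    DifferentiableOn ℂ (fun z => z ^ n * f z) {0}ᶜ := by
  intro z hz
  exact (differentiableAt_zpow.2 (Or.inl hz)).differentiableWithinAt.mul (hf z hz)

/-- Laurent coefficients do not depend on the radius, so Fourier uniqueness applies on the circle
through `z`. -/
theorem eq_zero_of_laurentCoeff_eq_zero {f : ℂ → ℂ} (hf : DifferentiableOn ℂ f {0}ᶜ)
    (h : ∀ n, laurentCoeff f n = 0) {z : ℂ} (hz : z ≠ 0) : f z = 0 := by
  have h1 := eq_zero_of_circleAverage_eq_zero (norm_pos_iff.2 hz) hf.continuousOn (fun n =>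
    (circleAverage_eq_one (differentiableOn_zpow_mul hf (-n)) (norm_pos_iff.2 hz)).trans (h n))
    z.arg
  rwa [circleMap, zero_add, Complex.norm_mul_exp_arg_mul_I] at h1

theorem circleIntegrable_of_differentiableOn {f : ℂ → ℂ} (hf : DifferentiableOn ℂ f {0}ᶜ) :
    CircleIntegrable f 0 1 :=
  (hf.continuousOn.mono fun z hz => by
    rintro rfl
    simp at hz).circleIntegrable zero_le_one

theorem laurentCoeff_add {f g : ℂ → ℂ} (hf : DifferentiableOn ℂ f {0}ᶜ)
    (hg : DifferentiableOn ℂ g {0}ᶜ) (n : ℤ) :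
    laurentCoeff (f + g) n = laurentCoeff f n + laurentCoeff g n := by
  unfold laurentCoeff
  rw [← Real.circleAverage_add
    (circleIntegrable_of_differentiableOn (differentiableOn_zpow_mul hf _))
    (circleIntegrable_of_differentiableOn (differentiableOn_zpow_mul hg _))]
  congr 1
  ext z
  simp [mul_add]

theorem laurentCoeff_smul (a : ℂ) (f : ℂ → ℂ) (n : ℤ) :
    laurentCoeff (a • f) n = a * laurentCoeff f n := by
  unfold laurentCoeff
  rw [← smul_eq_mul, ← Real.circleAverage_fun_smul]
  congr 1
  ext z
  simp only [Pi.smul_apply, smul_eq_mul]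
  ring

/-! ### Dimension bound and existence of zeros for `qSpace`. -/

theorem laurentCoeff_of_mem_qSpace {q : ℂ} (hq0 : q ≠ 0) {k : ℕ} {c : ℂ} {m : ℂ → ℂ}
    (hm : m ∈ qSpace q k c) (n : ℤ) :
    laurentCoeff m n = q ^ (-n) * c * laurentCoeff m (n + k) := by
  obtain ⟨hd, -, hq⟩ := hm
  unfold laurentCoeff
  rw [← circleAverage_comp_mul (differentiableOn_zpow_mul hd (-n)) hq0, ← smul_eq_mul (q ^ (-n) * c),
    ← Real.circleAverage_fun_smul]
  refine Real.circleAverage_congr_sphere fun z hz => ?_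
  have hz0 : z ≠ 0 := by
    rintro rfl
    simp at hz
  simp only [smul_eq_mul]
  rw [hq z hz0, mul_zpow, neg_add, zpow_add₀ hz0 (-n), zpow_neg z (k : ℤ), zpow_natCast]
  ring

/-- The first `k` Laurent coefficients of an element of `qSpace q k c`. -/
noncomputable def laurentMap (q : ℂ) (k : ℕ) (c : ℂ) : qSpace q k c →ₗ[ℂ] (Fin k → ℂ) where
  toFun m i := laurentCoeff m i
  map_add' f g := by
    ext i
    exact laurentCoeff_add f.2.1 g.2.1 i
  map_smul' a f := by
    ext i
    exact laurentCoeff_smul a f i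

/-- The recurrence links the coefficients `n` and `n + k` by a nonzero factor, so one coefficient
per residue class modulo `k` determines all of them. -/
theorem laurentMap_injective {q : ℂ} (hq0 : q ≠ 0) {k : ℕ} (hk : k ≠ 0) {c : ℂ} (hc : c ≠ 0) :
    Function.Injective (laurentMap q k c) := by
  rw [injective_iff_map_eq_zero]
  rintro ⟨m, hm⟩ h
  have hstep : ∀ n : ℤ, laurentCoeff m n = 0 ↔ laurentCoeff m (n + k) = 0 := by
    intro n
    rw [laurentCoeff_of_mem_qSpace hq0 hm n, mul_eq_zero]
    exact or_iff_right (mul_ne_zero (zpow_ne_zero _ hq0) hc)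
  have hall : ∀ (i j : ℤ), laurentCoeff m (i + k * j) = 0 ↔ laurentCoeff m i = 0 := by
    intro i j
    induction j using Int.induction_on with
    | zero => simp
    | succ j ih => rw [← ih, hstep (i + k * j)]; ring_nf
    | pred j ih => rw [← ih, hstep (i + k * (-j - 1))]; ring_nf
  have hzero : ∀ n, laurentCoeff m n = 0 := by
    intro n
    have hk' : (0 : ℤ) < k := by omega
    rw [← Int.emod_add_mul_ediv n k, hall]
    have h0 := Int.emod_nonneg n hk'.ne'
    have h1 := Int.emod_lt_of_pos n hk'
    have h2 := congrFun h ⟨(n % k).toNat, by omega⟩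
    simpa [laurentMap, Int.toNat_of_nonneg h0] using h2
  ext z
  rcases eq_or_ne z 0 with rfl | hz
  · exact hm.2.1
  · exact eq_zero_of_laurentCoeff_eq_zero hm.1 hzero hz

theorem finiteDimensional_qSpace {q : ℂ} (hq0 : q ≠ 0) {k : ℕ} (hk : k ≠ 0) {c : ℂ} (hc : c ≠ 0) :
    FiniteDimensional ℂ (qSpace q k c) :=
  FiniteDimensional.of_injective _ (laurentMap_injective hq0 hk hc)

theorem finrank_qSpace_le {q : ℂ} (hq0 : q ≠ 0) {k : ℕ} (hk : k ≠ 0) {c : ℂ} (hc : c ≠ 0) :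
    Module.finrank ℂ (qSpace q k c) ≤ k := by
  simpa using LinearMap.finrank_le_finrank_of_injective (laurentMap_injective hq0 hk hc)

/-- Elements of `qSpace q k c` with `k ≥ 1` have zeros: otherwise the mean value over a circle of
the logarithmic derivative `z m' / m` would change by `-k` under `z ↦ q z`. -/
theorem exists_zero_of_mem_qSpace {q : ℂ} (hq0 : q ≠ 0) {k : ℕ} (hk : k ≠ 0) {c : ℂ} (hc : c ≠ 0)
    {m : ℂ → ℂ} (hm : m ∈ qSpace q k c) : ∃ x : ℂ, x ≠ 0 ∧ m x = 0 := by
  by_contra! hne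
  obtain ⟨hd, -, hq⟩ := hm
  have hd' : DifferentiableOn ℂ (fun z => z * deriv m z / m z) {0}ᶜ :=
    (differentiableOn_id.mul (hd.deriv isOpen_compl_singleton)).div hd fun z hz => hne z hz
  have hrel : ∀ z : ℂ, z ≠ 0 →
      q * z * deriv m (q * z) / m (q * z) = z * deriv m z / m z - k := by
    intro z hz
    have hqz : q * z ≠ 0 := mul_ne_zero hq0 hz
    have hdm : ∀ w : ℂ, w ≠ 0 → HasDerivAt m (deriv m w) w := fun w hw =>
      (hd.differentiableAt (isOpen_compl_singleton.mem_nhds hw)).hasDerivAt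
    have h1 : HasDerivAt (fun w => m (q * w)) (q * deriv m (q * z)) z := by
      have := (hdm _ hqz).comp z ((hasDerivAt_id z).const_mul q)
      rwa [mul_one, mul_comm] at this
    have h2 : HasDerivAt (fun w => c * w ^ (-k : ℤ) * m w)
        (c * ((-k : ℤ) * z ^ (-k - 1 : ℤ)) * m z + c * z ^ (-k : ℤ) * deriv m z) z :=
      ((hasDerivAt_zpow _ z (Or.inl hz)).const_mul c).mul (hdm z hz)
    have h3 : (fun w => m (q * w)) =ᶠ[nhds z] fun w => c * w ^ (-k : ℤ) * m w := by
      filter_upwards [isOpen_compl_singleton.mem_nhds hz] with w hw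
      rw [hq w hw, zpow_neg, zpow_natCast]
    have h4 := h1.unique (h2.congr_of_eventuallyEq h3)
    have hmz := hne z hz
    have hzk : z ^ k ≠ 0 := pow_ne_zero k hz
    rw [hq z hz, mul_right_comm, h4, zpow_sub_one₀ hz, zpow_neg, zpow_natCast]
    push_cast
    field_simp
    ring
  have h5 := circleAverage_comp_mul hd' hq0
  have h6 : Real.circleAverage (fun z => q * z * deriv m (q * z) / m (q * z)) 0 1 =
      Real.circleAverage ((fun z => z * deriv m z / m z) - fun _ => (k : ℂ)) 0 1 := by
    refine Real.circleAverage_congr_sphere fun z hz => ?_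
    refine hrel z ?_
    rintro rfl
    simp at hz
  rw [h6, Real.circleAverage_sub (circleIntegrable_of_differentiableOn hd')
    (circleIntegrable_const _ _ _), Real.circleAverage_const] at h5
  simp [hk] at h5

/-! ### Theta products and the elements of degree two. -/

/-- The function `x ↦ θ_q(a x) θ_q(b x)` on `ℂ \ {0}`, extended by `0`. -/
noncomputable def thetaPair (q a b x : ℂ) : ℂ :=
  if x = 0 then 0 else thetaQ q (a * x) * thetaQ q (b * x)

theorem thetaPair_of_ne {q a b x : ℂ} (hx : x ≠ 0) :
    thetaPair q a b x = thetaQ q (a * x) * thetaQ q (b * x) := if_neg hx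

theorem differentiableOn_thetaQ_mul {q : ℂ} (hq1 : ‖q‖ < 1) {a : ℂ} (ha : a ≠ 0) :
    DifferentiableOn ℂ (fun x => thetaQ q (a * x)) {0}ᶜ :=
  (differentiableOn_thetaQ hq1).comp (differentiableOn_id.const_mul a) fun _ hx =>
    mul_ne_zero ha hx

theorem thetaQ_mul_mul {q : ℂ} (hq0 : q ≠ 0) (hq1 : ‖q‖ < 1) {a x : ℂ} (ha : a ≠ 0) (hx : x ≠ 0) :
    thetaQ q (a * (q * x)) = (a * x)⁻¹ * thetaQ q (a * x) := by
  rw [mul_left_comm, thetaQ_mul hq0 hq1 (mul_ne_zero ha hx)]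

theorem thetaPair_mem {q : ℂ} (hq0 : q ≠ 0) (hq1 : ‖q‖ < 1) {a b c : ℂ} (ha : a ≠ 0) (hb : b ≠ 0)
    (hc : a * b * c = 1) : thetaPair q a b ∈ qSpace q 2 c := by
  refine ⟨?_, if_pos rfl, fun x hx => ?_⟩
  · exact ((differentiableOn_thetaQ_mul hq1 ha).mul (differentiableOn_thetaQ_mul hq1 hb)).congr
      fun x hx => thetaPair_of_ne hx
  · rw [thetaPair_of_ne hx, thetaPair_of_ne (mul_ne_zero hq0 hx), thetaQ_mul_mul hq0 hq1 ha hx,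
      thetaQ_mul_mul hq0 hq1 hb hx, eq_inv_of_mul_eq_one_right hc]
    simp only [mul_inv]
    ring

theorem injOn_const_mul {a : ℂ} (ha : a ≠ 0) : Set.InjOn (fun x : ℂ => a * x) {0}ᶜ :=
  (mul_right_injective₀ ha).injOn

theorem thetaPair_ne_zero {q : ℂ} (hq0 : q ≠ 0) (hq1 : ‖q‖ < 1) {a b : ℂ} (ha : a ≠ 0)
    (hb : b ≠ 0) : thetaPair q a b ≠ 0 := by
  obtain ⟨x, hx, h⟩ := exists_thetaQ_ne_zero hq0 hq1 (fun (i : Fin 2) x => ![a, b] i * x)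
    (fun i => injOn_const_mul (by fin_cases i <;> simpa))
    (fun i x hx => mul_ne_zero (by fin_cases i <;> simpa) hx)
  intro h0
  have h1 := congrFun h0 x
  rw [thetaPair_of_ne hx, Pi.zero_apply, mul_eq_zero] at h1
  exact h1.elim (h 0) (h 1)

/-- An element of `qSpace q 2 c` is determined up to a scalar by one of its zeros. -/
theorem eq_mul_thetaPair_of_zero {q : ℂ} (hq0 : q ≠ 0) (hq1 : ‖q‖ < 1) {a b c : ℂ} (ha : a ≠ 0)
    (hb : b ≠ 0) (hc : a * b * c = 1) {m : ℂ → ℂ} (hm : m ∈ qSpace q 2 c) (h0 : m (-a⁻¹) = 0) :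
    ∃ l : ℂ, ∀ x, m x = l * thetaPair q a b x := by
  have hc0 : c ≠ 0 := right_ne_zero_of_mul_eq_one hc
  have hx0 : -a⁻¹ ≠ 0 := neg_ne_zero.2 (inv_ne_zero ha)
  -- A generic `s` makes `θ(s x) θ(x / (c s))`, which has the same multiplier, nonzero at `-a⁻¹`.
  -- Evaluation there removes it from the linear relation among three elements of a space of
  -- dimension at most 2.
  obtain ⟨s, hs, hs'⟩ := exists_thetaQ_ne_zero hq0 hq1
    (fun (i : Fin 2) s => if i = 0 then -a⁻¹ * s else (-a⁻¹ * c⁻¹) * s⁻¹) (by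
      intro i
      fin_cases i
      · exact injOn_const_mul hx0
      · exact ((mul_right_injective₀ (mul_ne_zero hx0 (inv_ne_zero hc0))).comp
          inv_injective).injOn) (by
      intro i x hx
      fin_cases i
      · exact mul_ne_zero hx0 hx
      · exact mul_ne_zero (mul_ne_zero hx0 (inv_ne_zero hc0)) (inv_ne_zero hx))
  have hsc : c⁻¹ * s⁻¹ ≠ 0 := mul_ne_zero (inv_ne_zero hc0) (inv_ne_zero hs)
  let f : qSpace q 2 c := ⟨m, hm⟩
  let g : qSpace q 2 c := ⟨thetaPair q a b, thetaPair_mem hq0 hq1 ha hb hc⟩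
  let h : qSpace q 2 c := ⟨thetaPair q s (c⁻¹ * s⁻¹), thetaPair_mem hq0 hq1 hs hsc (by field_simp)⟩
  have hg0 : g.1 (-a⁻¹) = 0 := by
    change thetaPair q a b (-a⁻¹) = 0
    rw [thetaPair_of_ne hx0, mul_neg, mul_inv_cancel₀ ha, thetaQ_neg_one hq0 hq1, zero_mul]
  have hh0 : h.1 (-a⁻¹) ≠ 0 := by
    change thetaPair q s (c⁻¹ * s⁻¹) (-a⁻¹) ≠ 0
    rw [thetaPair_of_ne hx0]
    refine mul_ne_zero ?_ ?_
    · simpa [mul_comm] using hs' 0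
    · simpa [mul_comm, mul_assoc, mul_left_comm] using hs' 1
  have := finiteDimensional_qSpace hq0 two_ne_zero hc0
  have hdep : ¬ LinearIndependent ℂ ![f, g, h] := fun hli => by
    have h1 := hli.fintype_card_le_finrank
    have h2 := finrank_qSpace_le hq0 two_ne_zero hc0
    simp at h1
    omega
  rw [Fintype.not_linearIndependent_iff] at hdep
  obtain ⟨w, hw, i, hi⟩ := hdep
  have hpt : ∀ x, w 0 * m x + w 1 * thetaPair q a b x + w 2 * h.1 x = 0 := by
    intro x
    have := congrFun (congrArg Subtype.val hw) x
    simpa [Fin.sum_univ_three, f, g] using this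
  have hw2 : w 2 = 0 := by
    have := hpt (-a⁻¹)
    rw [h0, show thetaPair q a b (-a⁻¹) = 0 from hg0] at this
    simpa [hh0] using this
  simp only [hw2, zero_mul, add_zero] at hpt
  have hw0 : w 0 ≠ 0 := by
    intro hw0
    have hw1 : w 1 = 0 := by
      by_contra hw1
      refine thetaPair_ne_zero hq0 hq1 ha hb (funext fun x => ?_)
      simpa [hw0, hw1] using hpt x
    fin_cases i <;> simp_all
  refine ⟨-w 1 / w 0, fun x => ?_⟩
  field_simp
  linear_combination hpt x

theorem thetaPair_comm (q a b : ℂ) : thetaPair q a b = thetaPair q b a := by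
  ext x
  unfold thetaPair
  rw [mul_comm]

theorem thetaPair_neg_inv_left {q : ℂ} (hq0 : q ≠ 0) (hq1 : ‖q‖ < 1) {a : ℂ} (ha : a ≠ 0) (b : ℂ) :
    thetaPair q a b (-a⁻¹) = 0 := by
  rw [thetaPair_of_ne (neg_ne_zero.2 (inv_ne_zero ha)), mul_neg, mul_inv_cancel₀ ha,
    thetaQ_neg_one hq0 hq1, zero_mul]

/-- A common theta factor can be cancelled from a relation between products, and what is left forces
a zero of the cofactor. -/
theorem zero_of_thetaPair_mul_eq {q : ℂ} (hq0 : q ≠ 0) (hq1 : ‖q‖ < 1) {a b e l l' : ℂ}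
    (ha : a ≠ 0) (hb : b ≠ 0) (he : e ≠ 0) (hl' : l' ≠ 0) (hbe : ¬ QCongr q e b) {f g : ℂ → ℂ}
    (hf : DifferentiableOn ℂ f {0}ᶜ) (hg : DifferentiableOn ℂ g {0}ᶜ)
    (h : ∀ x, l * thetaPair q a b x * f x = l' * thetaPair q a e x * g x) : g (-b⁻¹) = 0 := by
  have hda := differentiableOn_thetaQ_mul hq1 ha
  have hdr : DifferentiableOn ℂ (fun x => l * thetaQ q (b * x) * f x - l' * thetaQ q (e * x) * g x)
      {0}ᶜ :=
    (((differentiableOn_thetaQ_mul hq1 hb).const_mul l).mul hf).sub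
      (((differentiableOn_thetaQ_mul hq1 he).const_mul l').mul hg)
  -- Analytic functions on the connected set `{0}ᶜ` have no zero divisors, so `θ(a x)` cancels.
  have hor := (hda.analyticOnNhd isOpen_compl_singleton).eq_zero_or_eq_zero_of_mul_eq_zero
    (hdr.analyticOnNhd isOpen_compl_singleton) (fun x hx => by
      have := h x
      rw [thetaPair_of_ne hx, thetaPair_of_ne hx] at this
      linear_combination this)
    (isConnected_compl_singleton_of_one_lt_rank (by simp) 0).isPreconnected
  have hnz : ¬ ∀ x ∈ ({0}ᶜ : Set ℂ), thetaQ q (a * x) = 0 := by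
    intro h0
    obtain ⟨x, hx, hx'⟩ := exists_thetaQ_ne_zero hq0 hq1 (fun (_ : Unit) x => a * x)
      (fun _ => injOn_const_mul ha) (fun _ x hx => mul_ne_zero ha hx)
    exact hx' () (h0 x hx)
  have hx0 : -b⁻¹ ≠ 0 := neg_ne_zero.2 (inv_ne_zero hb)
  have h1 := hor.resolve_left hnz (-b⁻¹) hx0
  have hth : thetaQ q (e * -b⁻¹) ≠ 0 := fun h0 => by
    obtain ⟨n, hn⟩ := qCongr_of_thetaQ_eq_zero hq0 hq1 (mul_ne_zero he hx0)
      (neg_ne_zero.2 one_ne_zero) h0 (thetaQ_neg_one hq0 hq1)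
    exact hbe ⟨n, by rw [← hn]; field_simp⟩
  rw [mul_neg, mul_inv_cancel₀ hb, thetaQ_neg_one hq0 hq1] at h1
  rw [mul_neg] at hth
  simpa [hl', hth] using h1

/-! ### Factorization of singular matrices. -/

theorem qCongr_mul_right_iff {q c d t : ℂ} (ht : t ≠ 0) :
    QCongr q (c * t) (d * t) ↔ QCongr q c d := by
  unfold QCongr
  rw [mul_div_mul_right _ _ ht]

theorem qCongr_inv_iff {q c d : ℂ} : QCongr q c⁻¹ d⁻¹ ↔ QCongr q d c := by
  unfold QCongr
  rw [inv_div_inv]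

/-- `M` is the product of a column and a row of theta functions, with parameter `t`. -/
def ThetaFactorization (q : ℂ) (ρ σ : Fin 2 → ℂ) (M : Matrix (Fin 2) (Fin 2) (ℂ → ℂ)) (t : ℂ)
    (u w : Fin 2 → ℂ) : Prop :=
  (∀ i, u i ≠ 0) ∧ (∀ j, w j ≠ 0) ∧
    ∀ i j x, M i j x = u i * w j * thetaPair q (ρ i * t)⁻¹ (σ j * t) x

section

variable {q : ℂ} {ρ σ : Fin 2 → ℂ} {M : Matrix (Fin 2) (Fin 2) (ℂ → ℂ)}

theorem det_eq_zero_iff : M.det = 0 ↔ ∀ x, M 0 0 x * M 1 1 x = M 0 1 x * M 1 0 x := by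
  rw [Matrix.det_fin_two, sub_eq_zero, funext_iff]
  rfl

/-- The common zero gives the first row the factor `θ(x / (ρ 0 t))`, with cofactors `θ(σ j t x)`.
Cancelling that factor in `det M = 0` and using `σ 0 ≢ σ 1` makes each entry of the second row
vanish where its own `θ(σ j t x)` does, which fixes its shape. -/
theorem thetaFactorization_of_zero (hq0 : q ≠ 0) (hq1 : ‖q‖ < 1) (hρ : ∀ i, ρ i ≠ 0)
    (hσ : ∀ j, σ j ≠ 0) (hNRσ : ∀ i j, i ≠ j → ¬ QCongr q (σ i) (σ j))
    (hM : M ∈ detLocus q ρ σ) {t : ℂ} (ht : t ≠ 0)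
    (h0 : ∀ j, M 0 j (-(ρ 0 * t)) = 0) : ∃ u w, ThetaFactorization q ρ σ M t u w := by
  obtain ⟨hM, hdet⟩ := hM
  rw [det_eq_zero_iff] at hdet
  have hα : ∀ i, (ρ i * t)⁻¹ ≠ 0 := fun i => inv_ne_zero (mul_ne_zero (hρ i) ht)
  have hβ : ∀ j, σ j * t ≠ 0 := fun j => mul_ne_zero (hσ j) ht
  have hprod : ∀ i j, (ρ i * t)⁻¹ * (σ j * t) * (ρ i / σ j) = 1 := by
    intro i j
    have := hρ i
    have := hσ j
    field_simp
  have hrow0 : ∀ j, ∃ l : ℂ, ∀ x, M 0 j x = l * thetaPair q (ρ 0 * t)⁻¹ (σ j * t) x := fun j =>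
    eq_mul_thetaPair_of_zero hq0 hq1 (hα 0) (hβ j) (hprod 0 j) (hM 0 j).1 (by
      rw [inv_inv]; exact h0 j)
  have hne : ∀ {i j : Fin 2} {l : ℂ} {f : ℂ → ℂ}, (∀ x, M i j x = l * f x) → l ≠ 0 := by
    rintro i j l f hl rfl
    exact (hM i j).2 (funext fun x => by simp [hl x])
  choose l hl using hrow0
  have hl0 : ∀ j, l j ≠ 0 := fun j => hne (hl j)
  have hz0 : M 1 0 (-(σ 0 * t)⁻¹) = 0 :=
    zero_of_thetaPair_mul_eq hq0 hq1 (hα 0) (hβ 0) (hβ 1) (hl0 1)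
      (fun h => hNRσ 1 0 (by decide) ((qCongr_mul_right_iff ht).1 h)) (hM 1 1).1.1 (hM 1 0).1.1
      fun x => by rw [← hl, ← hl, hdet]
  have hz1 : M 1 1 (-(σ 1 * t)⁻¹) = 0 :=
    zero_of_thetaPair_mul_eq hq0 hq1 (hα 0) (hβ 1) (hβ 0) (hl0 0)
      (fun h => hNRσ 0 1 (by decide) ((qCongr_mul_right_iff ht).1 h)) (hM 1 0).1.1 (hM 1 1).1.1
      fun x => by rw [← hl, ← hl, hdet]
  have hrow1 : ∀ j, ∃ l : ℂ, ∀ x, M 1 j x = l * thetaPair q (ρ 1 * t)⁻¹ (σ j * t) x := by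
    intro j
    rw [thetaPair_comm]
    refine eq_mul_thetaPair_of_zero hq0 hq1 (hβ j) (hα 1) ?_ (hM 1 j).1 ?_
    · rw [mul_comm (σ j * t), hprod]
    · fin_cases j
      · exact hz0
      · exact hz1
  choose l' hl' using hrow1
  have hl0' : ∀ j, l' j ≠ 0 := fun j => hne (hl' j)
  -- The matrix of constants is also singular: evaluate the determinant at a point where none of the
  -- four thetas vanishes.
  have hcross : l 0 * l' 1 = l 1 * l' 0 := by
    obtain ⟨x, hx, hx'⟩ := exists_thetaQ_ne_zero hq0 hq1
      (fun (i : Fin 2 ⊕ Fin 2) x => Sum.elim (fun i => (ρ i * t)⁻¹) (fun j => σ j * t) i * x)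
      (fun i => injOn_const_mul (by cases i <;> simp [hρ, hσ, ht]))
      (fun i x hx => mul_ne_zero (by cases i <;> simp [hρ, hσ, ht]) hx)
    have hρx : ∀ i, thetaQ q ((ρ i * t)⁻¹ * x) ≠ 0 := fun i => hx' (Sum.inl i)
    have hσx : ∀ j, thetaQ q (σ j * t * x) ≠ 0 := fun j => hx' (Sum.inr j)
    have h := hdet x
    rw [hl, hl, hl', hl'] at h
    simp only [thetaPair_of_ne hx] at h
    refine mul_right_cancel₀ (mul_ne_zero (mul_ne_zero (hρx 0) (hρx 1))
      (mul_ne_zero (hσx 0) (hσx 1))) ?_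
    linear_combination h
  refine ⟨![l 0, l' 0], ![1, l 1 / l 0], ?_, ?_, ?_⟩
  · intro i
    fin_cases i
    · exact hl0 0
    · exact hl0' 0
  · intro j
    fin_cases j
    · exact one_ne_zero
    · exact div_ne_zero (hl0 1) (hl0 0)
  · have h00 := hl0 0
    intro i j x
    fin_cases i <;> fin_cases j
    · simpa using hl 0 x
    · simpa [mul_div_cancel₀ _ h00] using hl 1 x
    · simpa using hl' 0 x
    · have : l' 0 * (l 1 / l 0) = l' 1 := by
        field_simp
        linear_combination -hcross
      simpa [this] using hl' 1 x

/-- At a zero of `M 0 0`, the determinant relation makes `M 0 1` or `M 1 0` vanish. In the first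
case the first row has a common zero. In the second, the theta factor common to the first column
cancels, and `ρ 0 ≢ ρ 1` makes the complementary zero of `M 0 0` a zero of `M 0 1`. -/
theorem exists_thetaFactorization (hq0 : q ≠ 0) (hq1 : ‖q‖ < 1) (hρ : ∀ i, ρ i ≠ 0)
    (hσ : ∀ j, σ j ≠ 0) (hNRρ : ∀ i j, i ≠ j → ¬ QCongr q (ρ i) (ρ j))
    (hNRσ : ∀ i j, i ≠ j → ¬ QCongr q (σ i) (σ j)) (hM : M ∈ detLocus q ρ σ) :
    ∃ t u w, t ≠ 0 ∧ ThetaFactorization q ρ σ M t u w := by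
  suffices h : ∃ x, x ≠ 0 ∧ ∀ j, M 0 j x = 0 by
    obtain ⟨x, hx, h⟩ := h
    have ht : -x / ρ 0 ≠ 0 := div_ne_zero (neg_ne_zero.2 hx) (hρ 0)
    obtain ⟨u, w, hf⟩ := thetaFactorization_of_zero hq0 hq1 hρ hσ hNRσ hM ht fun j => by
      rw [mul_div_cancel₀ _ (hρ 0), neg_neg, h]
    exact ⟨_, u, w, ht, hf⟩
  obtain ⟨hM, hdet⟩ := hM
  rw [det_eq_zero_iff] at hdet
  have hc : ∀ i, ρ i / σ 0 ≠ 0 := fun i => div_ne_zero (hρ i) (hσ 0)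
  obtain ⟨x, hx, h00⟩ := exists_zero_of_mem_qSpace hq0 two_ne_zero (hc 0) (hM 0 0).1
  have hor := hdet x
  rw [h00, zero_mul, eq_comm, mul_eq_zero] at hor
  rcases hor with h01 | h10
  · exact ⟨x, hx, fun j => by fin_cases j <;> assumption⟩
  have ha : -x⁻¹ ≠ 0 := neg_ne_zero.2 (inv_ne_zero hx)
  have hxa : x = -(-x⁻¹)⁻¹ := by rw [inv_neg, inv_inv, neg_neg]
  generalize -x⁻¹ = a at ha hxa
  subst hxa
  have hb : ∀ i, (ρ i * (a / σ 0))⁻¹ ≠ 0 := fun i =>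
    inv_ne_zero (mul_ne_zero (hρ i) (div_ne_zero ha (hσ 0)))
  have hprod : ∀ i, a * (ρ i * (a / σ 0))⁻¹ * (ρ i / σ 0) = 1 := by
    intro i
    have := hρ i
    have := hσ 0
    field_simp
  obtain ⟨l, hl⟩ := eq_mul_thetaPair_of_zero hq0 hq1 ha (hb 0) (hprod 0) (hM 0 0).1 h00
  obtain ⟨l', hl'⟩ := eq_mul_thetaPair_of_zero hq0 hq1 ha (hb 1) (hprod 1) (hM 1 0).1 h10
  have hl0 : l' ≠ 0 := by
    rintro rfl
    exact (hM 1 0).2 (funext fun x => by simp [hl' x])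
  -- The common zero of the row is `-b⁻¹`, where `b` is the second theta parameter of `M 0 0`.
  refine ⟨_, neg_ne_zero.2 (inv_ne_zero (hb 0)), fun j => ?_⟩
  fin_cases j
  · change M 0 0 _ = 0
    rw [hl, thetaPair_comm, thetaPair_neg_inv_left hq0 hq1 (hb 0), mul_zero]
  · refine zero_of_thetaPair_mul_eq hq0 hq1 ha (hb 0) (hb 1) hl0 (fun h => ?_) (hM 1 1).1.1
      (hM 0 1).1.1 (l := l) fun x => ?_
    · rw [qCongr_inv_iff, qCongr_mul_right_iff (div_ne_zero ha (hσ 0))] at h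
      exact hNRρ 0 1 (by decide) h
    · rw [← hl, ← hl', hdet, mul_comm]
      rfl

end

/-! ### Rank one and the image of `rhoBracket`. -/

theorem rank_eq_one_of_eq_mul {A : Matrix (Fin 2) (Fin 2) ℂ} {U W : Fin 2 → ℂ} (hU : U ≠ 0)
    (hW : W ≠ 0) (hA : ∀ i j, A i j = U i * W j) : A.rank = 1 := by
  have hA' : A = Matrix.vecMulVec U W := by
    ext i j
    exact hA i j
  obtain ⟨i, hi⟩ := Function.ne_iff.1 hU
  obtain ⟨j, hj⟩ := Function.ne_iff.1 hW
  refine le_antisymm (hA' ▸ Matrix.rank_vecMulVec_le U W) (Nat.one_le_iff_ne_zero.2 fun h => ?_)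
  rw [Matrix.rank, Submodule.finrank_eq_zero, LinearMap.range_eq_bot] at h
  have h0 := congrFun (LinearMap.congr_fun h (Pi.single j 1)) i
  rw [Matrix.mulVecLin_apply, Matrix.mulVec_single_one, Matrix.col_apply, hA] at h0
  exact mul_ne_zero hi hj h0

theorem rhoPoint_eq_mk {A : Matrix (Fin 2) (Fin 2) ℂ} {U W : Fin 2 → ℂ}
    (hA : ∀ i j, A i j = U i * W j) (hr : A.rank = 1) (hW : ![W 1, W 0] ≠ 0) :
    rhoPoint A hr = Projectivization.mk ℂ ![W 1, W 0] hW := by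
  unfold rhoPoint
  split_ifs with h
  · rw [Projectivization.mk_eq_mk_iff']
    exact ⟨U 0, by simp [hA]⟩
  · rw [Projectivization.mk_eq_mk_iff']
    exact ⟨U 1, by simp [hA]⟩

theorem scaleP1_mk (c : ℂˣ) (a b : ℂ) (h : ![a, b] ≠ 0) (h' : ![(c : ℂ) * a, b] ≠ 0) :
    scaleP1 c (Projectivization.mk ℂ ![a, b] h) = Projectivization.mk ℂ ![(c : ℂ) * a, b] h' :=
  rfl

theorem thetaQ_pair_ne_zero {q : ℂ} (hq0 : q ≠ 0) (hq1 : ‖q‖ < 1) {a b : ℂ} (ha : a ≠ 0)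
    (hb : b ≠ 0) (hab : ¬ QCongr q a b) : ![thetaQ q a, thetaQ q b] ≠ 0 := fun h =>
  hab (qCongr_of_thetaQ_eq_zero hq0 hq1 ha hb (congrFun h 0) (congrFun h 1))

section

variable {q : ℂ} {ρ σ : Fin 2 → ℂ} {M : Matrix (Fin 2) (Fin 2) (ℂ → ℂ)} {t : ℂ} {u w : Fin 2 → ℂ}

theorem ThetaFactorization.evalAt_eq (h : ThetaFactorization q ρ σ M t u w) {x : ℂ} (hx : x ≠ 0)
    (i j : Fin 2) : evalAt M x i j =
      (u i * thetaQ q ((ρ i * t)⁻¹ * x)) * (w j * thetaQ q (σ j * t * x)) := by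
  rw [evalAt, Matrix.map_apply, h.2.2, thetaPair_of_ne hx]
  ring

theorem ThetaFactorization.rank_evalAt (hq0 : q ≠ 0) (hq1 : ‖q‖ < 1) (hρ : ∀ i, ρ i ≠ 0)
    (hσ : ∀ j, σ j ≠ 0) (hNRρ : ∀ i j, i ≠ j → ¬ QCongr q (ρ i) (ρ j))
    (hNRσ : ∀ i j, i ≠ j → ¬ QCongr q (σ i) (σ j)) (ht : t ≠ 0)
    (h : ThetaFactorization q ρ σ M t u w) {x : ℂ} (hx : x ≠ 0) : (evalAt M x).rank = 1 := by
  refine rank_eq_one_of_eq_mul (fun hU => ?_) (fun hW => ?_) (h.evalAt_eq hx)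
  · have h0 : ∀ i, thetaQ q ((ρ i * t)⁻¹ * x) = 0 := fun i =>
      (mul_eq_zero.1 (congrFun hU i)).resolve_left (h.1 i)
    have hne : ∀ i, (ρ i * t)⁻¹ * x ≠ 0 := fun i =>
      mul_ne_zero (inv_ne_zero (mul_ne_zero (hρ i) ht)) hx
    have := qCongr_of_thetaQ_eq_zero hq0 hq1 (hne 1) (hne 0) (h0 1) (h0 0)
    rw [qCongr_mul_right_iff hx, qCongr_inv_iff, qCongr_mul_right_iff ht] at this
    exact hNRρ 0 1 (by decide) this
  · have h0 : ∀ j, thetaQ q (σ j * t * x) = 0 := fun j =>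
      (mul_eq_zero.1 (congrFun hW j)).resolve_left (h.2.1 j)
    have hne : ∀ j, σ j * t * x ≠ 0 := fun j => mul_ne_zero (mul_ne_zero (hσ j) ht) hx
    have := qCongr_of_thetaQ_eq_zero hq0 hq1 (hne 0) (hne 1) (h0 0) (h0 1)
    rw [qCongr_mul_right_iff hx, qCongr_mul_right_iff ht] at this
    exact hNRσ 0 1 (by decide) this

theorem ThetaFactorization.rhoBracket_eq {t : ℂˣ} (h : ThetaFactorization q ρ σ M t u w)
    {x : Fin 4 → ℂ} (hx : ∀ k, x k ≠ 0) (hM : ∀ k, (evalAt M (x k)).rank = 1)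
    (hpt : ∀ k, ![thetaQ q (σ 1 * x k * t), thetaQ q (σ 0 * x k * t)] ≠ 0) :
    rhoBracket x M hM = Quotient.mk p1FourSetoid fun k =>
      Projectivization.mk ℂ ![thetaQ q (σ 1 * x k * t), thetaQ q (σ 0 * x k * t)] (hpt k) := by
  symm
  -- The ratio of the row constants is the same for all four points, hence a single diagonal
  -- scaling.
  refine Quotient.sound ⟨Units.mk0 (w 1 / w 0) (div_ne_zero (h.2.1 1) (h.2.1 0)), fun k => ?_⟩
  have hw0 := h.2.1 0
  have hw1 := h.2.1 1
  have hW : ![(fun j => w j * thetaQ q (σ j * t * x k)) 1,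
      (fun j => w j * thetaQ q (σ j * t * x k)) 0] ≠ 0 := fun h0 => by
    refine hpt k ?_
    have h1 : thetaQ q (σ 1 * t * x k) = 0 := (mul_eq_zero.1 (congrFun h0 0)).resolve_left hw1
    have h2 : thetaQ q (σ 0 * t * x k) = 0 := (mul_eq_zero.1 (congrFun h0 1)).resolve_left hw0
    rw [mul_right_comm (σ 1), mul_right_comm (σ 0), h1, h2]
    simp
  dsimp only
  rw [rhoPoint_eq_mk (h.evalAt_eq (hx k)) (hM k) hW, scaleP1_mk _ _ _ _ (fun h0 => hpt k (by
    have h1 := congrFun h0 0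
    have h2 := congrFun h0 1
    ext i
    fin_cases i
    · simpa [hw0, hw1] using h1
    · simpa using h2)), Projectivization.mk_eq_mk_iff']
  refine ⟨w 0, ?_⟩
  ext i
  fin_cases i
  · simp only [Units.val_mk0, mul_right_comm (σ 1)]
    simp [← mul_assoc, mul_div_cancel₀ _ hw0]
  · simp [mul_right_comm (σ 0)]

/-- The matrix with entries `θ_q(x / (ρ_i t)) θ_q(σ_j t x)`. -/
noncomputable def thetaMatrix (q : ℂ) (ρ σ : Fin 2 → ℂ) (t : ℂ) :
    Matrix (Fin 2) (Fin 2) (ℂ → ℂ) :=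
  Matrix.of fun i j => thetaPair q (ρ i * t)⁻¹ (σ j * t)

theorem thetaFactorization_thetaMatrix :
    ThetaFactorization q ρ σ (thetaMatrix q ρ σ t) t 1 1 :=
  ⟨fun _ => one_ne_zero, fun _ => one_ne_zero, fun i j x => by simp [thetaMatrix]⟩

theorem thetaMatrix_mem_detLocus (hq0 : q ≠ 0) (hq1 : ‖q‖ < 1) (hρ : ∀ i, ρ i ≠ 0)
    (hσ : ∀ j, σ j ≠ 0) (ht : t ≠ 0) : thetaMatrix q ρ σ t ∈ detLocus q ρ σ := by
  refine ⟨fun i j => ?_, ?_⟩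
  · have hα : (ρ i * t)⁻¹ ≠ 0 := inv_ne_zero (mul_ne_zero (hρ i) ht)
    have hβ : σ j * t ≠ 0 := mul_ne_zero (hσ j) ht
    refine ⟨thetaPair_mem hq0 hq1 hα hβ ?_, thetaPair_ne_zero hq0 hq1 hα hβ⟩
    have := hρ i
    have := hσ j
    field_simp
  · rw [det_eq_zero_iff]
    intro x
    simp only [thetaMatrix, Matrix.of_apply, thetaPair]
    split_ifs
    · rfl
    · ring

end

/-! ### The pencil of quadrics. -/

theorem quadricForm_add (a b : Fin 6 → ℂ) (v : Fin 4 → Fin 2 → ℂ) :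
    quadricForm (a + b) v = quadricForm a v + quadricForm b v := by
  simp only [quadricForm, Pi.add_apply]
  ring

theorem quadricForm_smul (c : ℂ) (a : Fin 6 → ℂ) (v : Fin 4 → Fin 2 → ℂ) :
    quadricForm (c • a) v = c * quadricForm a v := by
  simp only [quadricForm, Pi.smul_apply, smul_eq_mul]
  ring

/-- Every monomial is linear in each `v k` and contains exactly two numerators, whence `c ^ 2`. This
makes the vanishing independent of representatives and of the orbit point. -/
theorem quadricForm_rescale (a : Fin 6 → ℂ) (d : Fin 4 → ℂ) (c : ℂ) (v : Fin 4 → Fin 2 → ℂ) :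
    quadricForm a (fun k => d k • ![c * v k 0, v k 1]) =
      (d 0 * d 1 * d 2 * d 3 * c ^ 2) * quadricForm a v := by
  simp only [quadricForm, Pi.smul_apply, smul_eq_mul, Matrix.cons_val_zero, Matrix.cons_val_one]
  ring

theorem mem_quadricLocus_of_equiv {a : Fin 6 → ℂ} {v : Fin 4 → Fin 2 → ℂ} (hv : ∀ k, v k ≠ 0)
    (h0 : quadricForm a v = 0) {p : Fin 4 → P1}
    (hp : (Quotient.mk p1FourSetoid p) =
      Quotient.mk p1FourSetoid fun k => Projectivization.mk ℂ (v k) (hv k)) :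
    p ∈ quadricLocus a := by
  obtain ⟨c, hc⟩ := Quotient.exact hp.symm
  have hrep : ∀ k, ∃ d : ℂ, (p k).rep = d • ![(c : ℂ) * v k 0, v k 1] := by
    intro k
    have h1 : p k = Projectivization.mk ℂ (scaleLin c (v k))
        ((map_ne_zero_iff _ (scaleLin_injective c)).2 (hv k)) := hc k
    rw [h1]
    obtain ⟨d, hd⟩ := Projectivization.exists_smul_eq_mk_rep ℂ (scaleLin c (v k))
      ((map_ne_zero_iff _ (scaleLin_injective c)).2 (hv k))
    exact ⟨d, hd.symm⟩
  choose d hd using hrep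
  change quadricForm a (fun k => (p k).rep) = 0
  rw [funext hd, quadricForm_rescale, h0, mul_zero]

section

variable {q : ℂ} {σ : Fin 2 → ℂ} {x : Fin 4 → ℂ}

/-- Each monomial uses every `x k` once and each of `σ 0`, `σ 1` twice, so all six have the same
multiplier. -/
theorem quadricForm_theta_mem (hq0 : q ≠ 0) (hq1 : ‖q‖ < 1) (hσ : ∀ j, σ j ≠ 0)
    (hx : ∀ k, x k ≠ 0) (a : Fin 6 → ℂ) :
    (fun t => if t = 0 then 0 else quadricForm a fun k =>
      ![thetaQ q (σ 1 * x k * t), thetaQ q (σ 0 * x k * t)]) ∈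
      qSpace q 4 ((σ 0 * σ 1) ^ 2 * (x 0 * x 1 * x 2 * x 3))⁻¹ := by
  have hne : ∀ j k, σ j * x k ≠ 0 := fun j k => mul_ne_zero (hσ j) (hx k)
  refine ⟨?_, if_pos rfl, fun t ht => ?_⟩
  · have hd : ∀ j k, DifferentiableOn ℂ (fun t => thetaQ q (σ j * x k * t)) {0}ᶜ := fun j k =>
      differentiableOn_thetaQ_mul hq1 (hne j k)
    refine DifferentiableOn.congr (f := fun t => quadricForm a fun k =>
      ![thetaQ q (σ 1 * x k * t), thetaQ q (σ 0 * x k * t)]) ?_ fun t ht => if_neg ht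
    simp only [quadricForm, Matrix.cons_val_zero, Matrix.cons_val_one]
    fun_prop
  · have hth : ∀ j k, thetaQ q (σ j * x k * (q * t)) =
        (σ j * x k * t)⁻¹ * thetaQ q (σ j * x k * t) := fun j k =>
      thetaQ_mul_mul hq0 hq1 (hne j k) ht
    simp only [if_neg ht, if_neg (mul_ne_zero hq0 ht), quadricForm, Matrix.cons_val_zero,
      Matrix.cons_val_one, hth, mul_inv, mul_pow]
    ring

theorem exists_submodule_quadricForm_theta (hq0 : q ≠ 0) (hq1 : ‖q‖ < 1) (hσ : ∀ j, σ j ≠ 0)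
    (hx : ∀ k, x k ≠ 0) : ∃ P : Submodule ℂ (Fin 6 → ℂ),
    Module.finrank ℂ P = 2 ∧ ∀ a ∈ P, ∀ t : ℂ, t ≠ 0 →
      quadricForm a (fun k => ![thetaQ q (σ 1 * x k * t), thetaQ q (σ 0 * x k * t)]) = 0 := by
  set c : ℂ := ((σ 0 * σ 1) ^ 2 * (x 0 * x 1 * x 2 * x 3))⁻¹ with hc
  have hc0 : c ≠ 0 := by simp [hc, hσ, hx]
  let Φ : (Fin 6 → ℂ) →ₗ[ℂ] qSpace q 4 c :=
    { toFun := fun a => ⟨_, quadricForm_theta_mem hq0 hq1 hσ hx a⟩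
      map_add' := fun a b => by
        ext t
        by_cases ht : t = 0 <;> simp [ht, quadricForm_add]
      map_smul' := fun d a => by
        ext t
        by_cases ht : t = 0 <;> simp [ht, quadricForm_smul] }
  have := finiteDimensional_qSpace hq0 four_ne_zero hc0
  have hle : 2 ≤ Module.finrank ℂ (LinearMap.ker Φ) := by
    have h1 := Φ.finrank_range_add_finrank_ker
    have h2 := (Submodule.finrank_le (LinearMap.range Φ)).trans
      (finrank_qSpace_le hq0 four_ne_zero hc0)
    simp only [Module.finrank_fin_fun] at h1
    omega
  -- Rank-nullity gives only a lower bound for the kernel; two independent vectors in it span a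
  -- space of dimension exactly 2.
  obtain ⟨f, hf⟩ := exists_linearIndependent_of_le_finrank hle
  have hf' := hf.map' _ (LinearMap.ker Φ).ker_subtype
  refine ⟨Submodule.span ℂ (Set.range ((LinearMap.ker Φ).subtype ∘ f)), ?_, fun a ha t ht => ?_⟩
  · simpa using finrank_span_eq_card hf'
  · have hker : a ∈ LinearMap.ker Φ := by
      refine Submodule.span_le.2 ?_ ha
      rintro _ ⟨i, rfl⟩
      exact (f i).2
    have h0 := congrFun (congrArg Subtype.val hker) t
    simpa [Φ, ht] using h0

end

theorem mainTheorem12 (q : ℂ) (hq0 : q ≠ 0) (hq1 : ‖q‖ < 1)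
    (ρ σ : Fin 2 → ℂ) (x : Fin 4 → ℂ)
    (hρ : ∀ i, ρ i ≠ 0) (hσ : ∀ j, σ j ≠ 0) (hx : ∀ k, x k ≠ 0)
    (hNRρ : ∀ i j, i ≠ j → ¬ QCongr q (ρ i) (ρ j))
    (hNRσ : ∀ i j, i ≠ j → ¬ QCongr q (σ i) (σ j))
    (hNRx : ∀ k l, k ≠ l → ¬ QCongr q (x k) (x l))
    (hFR : x 0 * x 1 * x 2 * x 3 = (ρ 0 * ρ 1) / (σ 0 * σ 1)) :
    ∃ (hrank : ∀ M ∈ detLocus q ρ σ, ∀ k, (evalAt M (x k)).rank = 1)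
      (hpt : ∀ (t : ℂˣ) (k : Fin 4),
        ![thetaQ q (σ 1 * x k * t), thetaQ q (σ 0 * x k * t)] ≠ 0),
      (Set.range fun M : detLocus q ρ σ => rhoBracket x M.1 (hrank M.1 M.2)) =
        (Set.range fun t : ℂˣ => (Quotient.mk p1FourSetoid fun k =>
          Projectivization.mk ℂ ![thetaQ q (σ 1 * x k * t), thetaQ q (σ 0 * x k * t)] (hpt t k))) ∧
      ∃ P : Submodule ℂ (Fin 6 → ℂ), Module.finrank ℂ P = 2 ∧
        ∀ a ∈ P, ∀ p : Fin 4 → P1,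
          Quotient.mk p1FourSetoid p ∈
            (Set.range fun M : detLocus q ρ σ => rhoBracket x M.1 (hrank M.1 M.2)) →
          p ∈ quadricLocus a := by
  have hrank : ∀ M ∈ detLocus q ρ σ, ∀ k, (evalAt M (x k)).rank = 1 := by
    intro M hM k
    obtain ⟨t, u, w, ht, h⟩ := exists_thetaFactorization hq0 hq1 hρ hσ hNRρ hNRσ hM
    exact h.rank_evalAt hq0 hq1 hρ hσ hNRρ hNRσ ht (hx k)
  have hpt : ∀ (t : ℂˣ) (k : Fin 4),
      ![thetaQ q (σ 1 * x k * t), thetaQ q (σ 0 * x k * t)] ≠ 0 := by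
    intro t k
    have hne : ∀ j, σ j * x k * t ≠ 0 := fun j =>
      mul_ne_zero (mul_ne_zero (hσ j) (hx k)) t.ne_zero
    refine thetaQ_pair_ne_zero hq0 hq1 (hne 1) (hne 0) ?_
    rw [qCongr_mul_right_iff t.ne_zero, qCongr_mul_right_iff (hx k)]
    exact hNRσ 1 0 (by decide)
  have himage : (Set.range fun M : detLocus q ρ σ => rhoBracket x M.1 (hrank M.1 M.2)) =
      Set.range fun t : ℂˣ => (Quotient.mk p1FourSetoid fun k =>
        Projectivization.mk ℂ ![thetaQ q (σ 1 * x k * t), thetaQ q (σ 0 * x k * t)]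
          (hpt t k)) := by
    apply Set.Subset.antisymm
    · rintro _ ⟨⟨M, hM⟩, rfl⟩
      obtain ⟨t, u, w, ht, h⟩ := exists_thetaFactorization hq0 hq1 hρ hσ hNRρ hNRσ hM
      exact ⟨Units.mk0 t ht, (ThetaFactorization.rhoBracket_eq (t := Units.mk0 t ht) h hx
        (hrank M hM) (hpt _)).symm⟩
    · rintro _ ⟨t, rfl⟩
      exact ⟨⟨thetaMatrix q ρ σ t, thetaMatrix_mem_detLocus hq0 hq1 hρ hσ t.ne_zero⟩,
        thetaFactorization_thetaMatrix.rhoBracket_eq hx _ (hpt t)⟩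
  refine ⟨hrank, hpt, himage, ?_⟩
  obtain ⟨P, hP, hP0⟩ := exists_submodule_quadricForm_theta hq0 hq1 hσ hx
  refine ⟨P, hP, fun a ha p hp => ?_⟩
  rw [himage] at hp
  obtain ⟨t, ht⟩ := hp
  exact mem_quadricLocus_of_equiv (hpt t) (hP0 a ha t t.ne_zero) ht.symm
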